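/- Let $\Omega\subset\mathbb R^d$, $d\ge 2$, be a bounded Lipschitz domain (open, connected), let $k>0$, and let $q_0>0$ be a constant such that $k$ is not a resonance frequency for $q_0$, i.e. the only $u\in H^1(\Omega)$ with $\int_\Omega(\nabla u\cdot\nabla v-k^2q_0uv)\,dx=0$ for all $v\in H^1(\Omega)$ is $u=0$. For $g\in L^2(\partial\Omega)$ let $u^{(g)}\in H^1(\Omega)$ denote the weak solution of $\Delta u+k^2q_0u=0$ in $\Omega$, $\partial_\nu u=g$ on $\partial\Omega$, that is, $$\int_\Omega\bigl(\nabla u^{(g)}\cdot\nabla v-k^2q_0\,u^{(g)}v\bigr)\,dx=\int_{\partial\Omega}g\,v\,ds\qquad\text{for all }v\in H^1(\Omega).$$ Let $g_1,\dots,g_n$ be an orthonormal family in the real space $L^2(\partial\Omega)$, and for $h\in L^\infty(\Omega)$ put $$F_n'(q_0)h:=\Bigl(\int_\Omega k^2\,h\,u^{(g_i)}u^{(g_j)}\,dx\Bigr)_{i,j=1}^n\in\mathbb R^{n\times n}.$$ Let $P_1,\dots,P_M\subset\Omega$ be nonempty, pairwise disjoint open sets (pixels) with $\overline\Omega=\bigcup_{m=1}^M\overline{P_m}$.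 Then for every pixel $P_m$ the matrix $$F_n'(q_0)\chi_{P_m}=\Bigl(\int_{P_m}k^2\,u^{(g_i)}u^{(g_j)}\,dx\Bigr)_{i,j=1}^n$$ is symmetric positive definite. -/

import Mathlib

open MeasureTheory Set Filter Topology
open scoped ContDiff Gradient ENNReal NNReal

noncomputable section

namespace Helmholtz

/-- A bounded Lipschitz domain in `ℝᵈ`: nonempty, open, connected, bounded, and near each boundary
point it is, for some unit vector `e` and some Lipschitz function `γ`, the region
`⟪e, y⟫ > γ(y')` above the graph of `γ`, where `y' = y - ⟪e, y⟫ e` is the component of `y`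
orthogonal to `e`. (A Lipschitz function on `e^⊥` extends to all of `ℝᵈ`, so `γ` may be taken
to be defined everywhere.) -/
structure IsLipschitzDomain {d : ℕ} (Ω : Set (EuclideanSpace ℝ (Fin d))) : Prop where
  isOpen : IsOpen Ω
  isConnected : IsConnected Ω
  isBounded : Bornology.IsBounded Ω
  locally_graph : ∀ x ∈ frontier Ω, ∃ e : EuclideanSpace ℝ (Fin d), ‖e‖ = 1 ∧
    ∃ (K : ℝ≥0) (γ : EuclideanSpace ℝ (Fin d) → ℝ), LipschitzWith K γ ∧
      ∃ r : ℝ, 0 < r ∧ ∀ y ∈ Metric.ball x r,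
        (y ∈ Ω ↔ γ (y - (inner ℝ e y) • e) < inner ℝ e y)

/-- The surface measure `ds` on `∂Ω`: the `(d-1)`-dimensional Hausdorff measure, normalised to
agree with Lebesgue measure on `ℝᵈ⁻¹`, restricted to the boundary of `Ω`. -/
def surfaceMeasure {d : ℕ} (Ω : Set (EuclideanSpace ℝ (Fin d))) :
    Measure (EuclideanSpace ℝ (Fin d)) :=
  (Measure.euclideanHausdorffMeasure (d - 1)).restrict (frontier Ω)

/-- `G` is the weak gradient of `u` in `Ω`: `∫_Ω u ∂_w φ dx = - ∫_Ω (G · w) φ dx` for all test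
functions `φ ∈ C_c^∞(Ω)` and all directions `w`. -/
def IsWeakGradient {d : ℕ} (Ω : Set (EuclideanSpace ℝ (Fin d)))
    (u : EuclideanSpace ℝ (Fin d) → ℝ)
    (G : EuclideanSpace ℝ (Fin d) → EuclideanSpace ℝ (Fin d)) : Prop :=
  ∀ φ : EuclideanSpace ℝ (Fin d) → ℝ, ContDiff ℝ ∞ φ → HasCompactSupport φ → tsupport φ ⊆ Ω →
    ∀ w : EuclideanSpace ℝ (Fin d),
      ∫ x in Ω, u x * fderiv ℝ φ x w = - ∫ x in Ω, inner ℝ (G x) w * φ x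

/-- `u ∈ H¹(Ω)` with weak gradient `∇u = G ∈ L²(Ω)ᵈ`. -/
structure IsSobolevH1 {d : ℕ} (Ω : Set (EuclideanSpace ℝ (Fin d)))
    (u : EuclideanSpace ℝ (Fin d) → ℝ)
    (G : EuclideanSpace ℝ (Fin d) → EuclideanSpace ℝ (Fin d)) : Prop where
  memLp : MemLp u 2 (volume.restrict Ω)
  memLp_grad : MemLp G 2 (volume.restrict Ω)
  isWeakGradient : IsWeakGradient Ω u G

/-- `t ∈ L²(∂Ω)` is the trace on `∂Ω` of the function `v ∈ H¹(Ω)` with weak gradient `G`: there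
are smooth functions on `ℝᵈ` which converge to `v` in `H¹(Ω)` and whose boundary values converge
to `t` in `L²(∂Ω)`. -/
def IsTrace {d : ℕ} (Ω : Set (EuclideanSpace ℝ (Fin d)))
    (v : EuclideanSpace ℝ (Fin d) → ℝ)
    (G : EuclideanSpace ℝ (Fin d) → EuclideanSpace ℝ (Fin d))
    (t : EuclideanSpace ℝ (Fin d) → ℝ) : Prop :=
  MemLp t 2 (surfaceMeasure Ω) ∧
    ∃ φ : ℕ → EuclideanSpace ℝ (Fin d) → ℝ, (∀ j, ContDiff ℝ ∞ (φ j)) ∧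
      Tendsto (fun j => eLpNorm (φ j - v) 2 (volume.restrict Ω)) atTop (𝓝 0) ∧
      Tendsto (fun j => eLpNorm (∇ (φ j) - G) 2 (volume.restrict Ω)) atTop (𝓝 0) ∧
      Tendsto (fun j => eLpNorm (φ j - t) 2 (surfaceMeasure Ω)) atTop (𝓝 0)

/-- `u ∈ H¹(Ω)` is a weak solution of `Δu + k² q u = 0` in `Ω`, `∂_ν u = g` on `∂Ω`:
`∫_Ω (∇u · ∇v - k² q u v) dx = ∫_{∂Ω} g v ds` for all `v ∈ H¹(Ω)`, where the values of `v`
on `∂Ω` are its trace `t`. -/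
def IsWeakSolution {d : ℕ} (Ω : Set (EuclideanSpace ℝ (Fin d))) (k : ℝ)
    (q : EuclideanSpace ℝ (Fin d) → ℝ) (g : Lp ℝ 2 (surfaceMeasure Ω))
    (u : EuclideanSpace ℝ (Fin d) → ℝ) : Prop :=
  ∃ G, IsSobolevH1 Ω u G ∧
    ∀ v H t, IsSobolevH1 Ω v H → IsTrace Ω v H t →
      ∫ x in Ω, (inner ℝ (G x) (H x) - k ^ 2 * q x * u x * v x) =
        ∫ x, g x * t x ∂(surfaceMeasure Ω)

/-- `k` is a resonance frequency for the refractive index `q` (that is, `q ∈ L_k(Ω)`): the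
homogeneous Neumann problem `Δu + k² q u = 0` in `Ω`, `∂_ν u = 0` on `∂Ω` has a weak solution
`u ∈ H¹(Ω)` which is nontrivial. -/
def IsResonant {d : ℕ} (Ω : Set (EuclideanSpace ℝ (Fin d))) (k : ℝ)
    (q : EuclideanSpace ℝ (Fin d) → ℝ) : Prop :=
  ∃ u G, IsSobolevH1 Ω u G ∧ ¬ (u =ᵐ[volume.restrict Ω] 0) ∧
    ∀ v H, IsSobolevH1 Ω v H →
      ∫ x in Ω, (inner ℝ (G x) (H x) - k ^ 2 * q x * u x * v x) = 0

/-- `P 0, …, P (M - 1)` are pixels discretizing `Ω`: nonempty, pairwise disjoint open subsets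
of `Ω` whose closures together make up the closure of `Ω`. -/
structure IsPixelPartition {d M : ℕ} (Ω : Set (EuclideanSpace ℝ (Fin d)))
    (P : Fin M → Set (EuclideanSpace ℝ (Fin d))) : Prop where
  isOpen : ∀ m, IsOpen (P m)
  nonempty : ∀ m, (P m).Nonempty
  subset : ∀ m, P m ⊆ Ω
  disjoint : Pairwise fun m m' => Disjoint (P m) (P m')
  closure_eq : closure Ω = ⋃ m, closure (P m)

/-- The linearized measurement matrix `F_n'(q₀) h = (∫_Ω k² h u_i u_j dx)_{i,j}`, where `u_i` is
the field `u_{q₀}^{(g_i)}` produced by the Neumann datum `g_i` in the background medium. -/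
def linearizedMeasurement {d n : ℕ} (Ω : Set (EuclideanSpace ℝ (Fin d))) (k : ℝ)
    (u : Fin n → EuclideanSpace ℝ (Fin d) → ℝ) (h : EuclideanSpace ℝ (Fin d) → ℝ) :
    Matrix (Fin n) (Fin n) ℝ :=
  Matrix.of fun i j => ∫ x in Ω, k ^ 2 * h x * u i x * u j x

end Helmholtz

end

/-! For c ∈ ℝⁿ put w = ∑ cᵢ uᵢ. The quadratic form of the matrix at c is k² ∫_P w², so positivity
can fail only if w = 0 a.e. on the pixel P. Unique continuation (`IsDistribSolution.ae_eq_zero`)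
then spreads the zero from P to all of Ω. The weak gradient of w vanishes as well, and testing with
smooth functions that need not vanish on ∂Ω shows that ∑ cᵢ gᵢ integrates to zero against each of
them, hence is zero. Orthonormal data are linearly independent, so c = 0
(`eq_zero_of_sum_ae_eq_zero`).

Unique continuation rests on quantitative analyticity, accessible here because the coefficient is
constant. An interior gradient estimate (`exists_gradient_estimate`), iterated k times over shells
of width R/k, bounds k-th directional derivatives by (Ck/R)^k M. Since k^k/k! ≤ e^k, the Taylor
remainder along a ray from a point near which the solution vanishes tends to zero up to a distance c
R, with c independent of the solution (`exists_radius_unique_continuation`). This uniformity lets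
the result survive the limit of mollifications, and lets a connectedness argument exhaust Ω. -/

namespace Helmholtz

variable {d : ℕ}

local notation "𝔼" => EuclideanSpace ℝ (Fin d)

/-! ### Directional derivatives and the Laplacian -/

/-- The derivative of `f` in the direction `v`, as a function of the point. -/
noncomputable def dirDeriv (v : EuclideanSpace ℝ (Fin d)) (f : EuclideanSpace ℝ (Fin d) → ℝ) :
    EuclideanSpace ℝ (Fin d) → ℝ :=
  fun x => fderiv ℝ f x v

/-- The Laplacian as the sum of the second derivatives in the coordinate directions. -/
noncomputable def coordLaplacian (f : EuclideanSpace ℝ (Fin d) → ℝ) :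
    EuclideanSpace ℝ (Fin d) → ℝ :=
  fun x => ∑ i : Fin d, dirDeriv (EuclideanSpace.single i 1)
    (dirDeriv (EuclideanSpace.single i 1) f) x

theorem contDiff_dirDeriv {f : 𝔼 → ℝ} (hf : ContDiff ℝ ∞ f) (v : 𝔼) :
    ContDiff ℝ ∞ (dirDeriv v f) :=
  (hf.fderiv_right (m := ∞) (by simp)).clm_apply contDiff_const

theorem contDiff_iterate_dirDeriv {f : 𝔼 → ℝ} (hf : ContDiff ℝ ∞ f) (v : 𝔼) (k : ℕ) :
    ContDiff ℝ ∞ ((dirDeriv v)^[k] f) := by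
  induction k generalizing f with
  | zero => exact hf
  | succ k ih => exact ih (contDiff_dirDeriv hf v)

theorem contDiff_coordLaplacian {f : 𝔼 → ℝ} (hf : ContDiff ℝ ∞ f) :
    ContDiff ℝ ∞ (coordLaplacian f) :=
  ContDiff.sum fun _ _ => contDiff_dirDeriv (contDiff_dirDeriv hf _) _

theorem tsupport_dirDeriv_subset (f : 𝔼 → ℝ) (v : 𝔼) : tsupport (dirDeriv v f) ⊆ tsupport f :=
  (closure_mono fun x hx => by
    rw [Function.mem_support] at hx ⊢
    intro h
    exact hx (by simp [dirDeriv, h])).trans (tsupport_fderiv_subset ℝ (f := f))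

theorem hasCompactSupport_dirDeriv {f : 𝔼 → ℝ} (hf : HasCompactSupport f) (v : 𝔼) :
    HasCompactSupport (dirDeriv v f) :=
  hf.of_isClosed_subset (isClosed_tsupport _) (tsupport_dirDeriv_subset f v)

theorem dirDeriv_comm {f : 𝔼 → ℝ} (hf : ContDiff ℝ ∞ f) (v w : 𝔼) :
    dirDeriv v (dirDeriv w f) = dirDeriv w (dirDeriv v f) := by
  have key : ∀ v w x, dirDeriv v (dirDeriv w f) x = fderiv ℝ (fderiv ℝ f) x v w := by
    intro v w x
    have h : DifferentiableAt ℝ (fderiv ℝ f) x :=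
      ((hf.fderiv_right (m := ∞) (by simp)).differentiable (by simp)).differentiableAt
    unfold dirDeriv
    rw [fderiv_clm_apply h (differentiableAt_const w)]
    simp
  funext x
  rw [key, key]
  exact ((contDiff_infty.1 hf 2).contDiffAt.isSymmSndFDerivAt (by simp)).eq v w

/-- Symmetry of second derivatives. Through it derivatives of solutions are again solutions, so the
gradient estimate can be iterated. -/
theorem coordLaplacian_dirDeriv {f : 𝔼 → ℝ} (hf : ContDiff ℝ ∞ f) (v : 𝔼) :
    coordLaplacian (dirDeriv v f) = dirDeriv v (coordLaplacian f) := by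
  funext x
  have h : ∀ i : Fin d, DifferentiableAt ℝ (dirDeriv (EuclideanSpace.single i 1)
    (dirDeriv (EuclideanSpace.single i 1) f)) x := fun i =>
    ((contDiff_dirDeriv (contDiff_dirDeriv hf _) _).differentiable (by simp)).differentiableAt
  have e : dirDeriv v (coordLaplacian f) x = ∑ i : Fin d, dirDeriv v
      (dirDeriv (EuclideanSpace.single i 1) (dirDeriv (EuclideanSpace.single i 1) f)) x := by
    unfold coordLaplacian
    rw [dirDeriv, fderiv_fun_sum fun i _ => h i]
    simp [dirDeriv]
  rw [e]
  unfold coordLaplacian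
  refine Finset.sum_congr rfl fun i _ => ?_
  rw [dirDeriv_comm hf _ v, dirDeriv_comm (contDiff_dirDeriv hf _) _ v]

theorem fderiv_apply_eq_sum (L : 𝔼 →L[ℝ] ℝ) (y : 𝔼) :
    L y = ∑ i : Fin d, y i * L (EuclideanSpace.single i 1) := by
  conv_lhs => rw [← (EuclideanSpace.basisFun (Fin d) ℝ).sum_repr y]
  simp

/-- Integration by parts against a compactly supported function. -/
theorem integral_mul_dirDeriv {f g : 𝔼 → ℝ} (hf : ContDiff ℝ ∞ f) (hg : ContDiff ℝ ∞ g)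
    (hc : HasCompactSupport g) (v : 𝔼) :
    ∫ x, f x * dirDeriv v g x = - ∫ x, dirDeriv v f x * g x := by
  have hg' := contDiff_dirDeriv hg v
  have hf' := contDiff_dirDeriv hf v
  refine integral_mul_fderiv_eq_neg_fderiv_mul_of_integrable ?_ ?_ ?_ ?_ ?_
  · exact (hf'.continuous.mul hg.continuous).integrable_of_hasCompactSupport hc.mul_left
  · exact (hf.continuous.mul hg'.continuous).integrable_of_hasCompactSupport
      (hasCompactSupport_dirDeriv hc v).mul_left
  · exact (hf.continuous.mul hg.continuous).integrable_of_hasCompactSupport hc.mul_left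
  · exact fun x _ => (hf.differentiable (by simp)).differentiableAt
  · exact fun x _ => (hg.differentiable (by simp)).differentiableAt

/-! ### Interior gradient estimate by radial averages -/

/-- A radial mollifier `η` of mass one, supported in the unit ball, together with a compactly
supported `Φ` such that `∇Φ (y) = η(y) y`. -/
theorem exists_radial_kernel (d : ℕ) : ∃ η Φ : EuclideanSpace ℝ (Fin d) → ℝ,
    ContDiff ℝ ∞ η ∧ ContDiff ℝ ∞ Φ ∧
    tsupport η ⊆ Metric.closedBall 0 1 ∧ tsupport Φ ⊆ Metric.closedBall 0 1 ∧
    (∀ y v, dirDeriv v Φ y = η y * inner ℝ y v) ∧ ∫ y, η y = 1 := by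
  let b : ContDiffBump (0 : ℝ) := ⟨1 / 2, 1, by norm_num, by norm_num⟩
  have hb : ContDiff ℝ ∞ b := b.contDiff
  have hb0 : ∀ s : ℝ, 1 ≤ s → b s = 0 := fun s hs =>
    b.zero_of_le_dist (by simpa [b] using hs.trans (le_abs_self s))
  -- The primitive is based at 1, where `b` has already died out, so that H(‖y‖²) vanishes outside
  -- the unit ball.
  let H : ℝ → ℝ := fun s => ∫ t in (1 : ℝ)..s, b t
  have hH : ∀ s, HasDerivAt H (b s) s := fun s =>
    intervalIntegral.integral_hasDerivAt_right (hb.continuous.intervalIntegrable _ _)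
      (hb.continuous.stronglyMeasurableAtFilter _ _) hb.continuous.continuousAt
  have hHs : ContDiff ℝ ∞ H := by
    rw [contDiff_infty_iff_deriv]
    refine ⟨fun s => (hH s).differentiableAt, ?_⟩
    rwa [show deriv H = b from funext fun s => (hH s).deriv]
  have hH0 : ∀ s : ℝ, 1 ≤ s → H s = 0 := fun s hs => by
    refine intervalIntegral.integral_zero_ae (Eventually.of_forall fun t ht => hb0 t ?_)
    rw [uIoc_of_le hs] at ht
    exact ht.1.le
  have hsupp : ∀ F : ℝ → ℝ, (∀ s : ℝ, 1 ≤ s → F s = 0) →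
      tsupport (fun y : EuclideanSpace ℝ (Fin d) => F (‖y‖ ^ 2)) ⊆ Metric.closedBall 0 1 := by
    intro F hF
    refine closure_minimal (fun y hy => ?_) Metric.isClosed_closedBall
    rw [mem_closedBall_zero_iff]
    by_contra! h
    exact hy (hF _ (by nlinarith))
  have hη : ContDiff ℝ ∞ fun y : EuclideanSpace ℝ (Fin d) => b (‖y‖ ^ 2) :=
    hb.comp (contDiff_norm_sq ℝ)
  have hηc : HasCompactSupport fun y : EuclideanSpace ℝ (Fin d) => b (‖y‖ ^ 2) :=
    (isCompact_closedBall _ _).of_isClosed_subset (isClosed_tsupport _) (hsupp _ hb0)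
  have hpos : 0 < ∫ y : EuclideanSpace ℝ (Fin d), b (‖y‖ ^ 2) := by
    refine hη.continuous.integral_pos_of_hasCompactSupport_nonneg_nonzero hηc
      (fun y => b.nonneg) (x := 0) ?_
    have : b 0 = 1 := b.one_of_mem_closedBall (by simp [b])
    simp [this]
  set c := ∫ y : EuclideanSpace ℝ (Fin d), b (‖y‖ ^ 2) with hc
  -- The factor 1/2 in Φ cancels the 2 in ∇‖y‖² = 2y.
  refine ⟨fun y => c⁻¹ * b (‖y‖ ^ 2), fun y => (c⁻¹ / 2) * H (‖y‖ ^ 2),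
    contDiff_const.mul hη, contDiff_const.mul (hHs.comp (contDiff_norm_sq ℝ)),
    hsupp (fun s => c⁻¹ * b s) (fun s hs => by simp [hb0 s hs]),
    hsupp (fun s => (c⁻¹ / 2) * H s) (fun s hs => by simp [hH0 s hs]), ?_, ?_⟩
  · intro y v
    have h1 : HasFDerivAt (fun y : EuclideanSpace ℝ (Fin d) => (c⁻¹ / 2) * H (‖y‖ ^ 2)) _ y :=
      ((hH _).comp_hasFDerivAt y (hasStrictFDerivAt_norm_sq y).hasFDerivAt).const_mul (c⁻¹ / 2)
    rw [dirDeriv, h1.fderiv]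
    simp
    ring
  · rw [integral_const_mul, inv_mul_cancel₀ hpos.ne']

/-- Differentiation of dilated averages under the integral sign. -/
theorem hasDerivAt_integral_dilation {p η : 𝔼 → ℝ} (hp : ContDiff ℝ ∞ p) (hη : Continuous η)
    (hc : HasCompactSupport η) (x : 𝔼) (r : ℝ) :
    HasDerivAt (fun r : ℝ => ∫ y, p (x + r • y) * η y)
      (∫ y, fderiv ℝ p (x + r • y) y * η y) r := by
  have hp' : Continuous (fderiv ℝ p) := hp.continuous_fderiv (by simp)
  have hcont : Continuous fun z : ℝ × 𝔼 => fderiv ℝ p (x + z.1 • z.2) z.2 :=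
    (hp'.comp (by fun_prop)).clm_apply continuous_snd
  -- The dominating function is C‖η‖, with C the bound on a compact neighbourhood of r times the
  -- support of η; off the support the integrand is zero.
  obtain ⟨C, hC⟩ := ((isCompact_closedBall r 1).prod hc.isCompact).exists_bound_of_continuousOn
    hcont.continuousOn
  refine (hasDerivAt_integral_of_dominated_loc_of_deriv_le (s := Metric.closedBall r 1)
    (F := fun r y => p (x + r • y) * η y) (F' := fun r y => fderiv ℝ p (x + r • y) y * η y)
    (bound := fun y => C * ‖η y‖)
    (Metric.closedBall_mem_nhds r one_pos) ?_ ?_ ?_ ?_ ?_ ?_).2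
  · exact Eventually.of_forall fun s =>
      ((hp.continuous.comp (by fun_prop)).mul hη).aestronglyMeasurable
  · exact ((hp.continuous.comp (by fun_prop)).mul hη).integrable_of_hasCompactSupport hc.mul_left
  · exact ((hcont.comp (by fun_prop : Continuous fun y : 𝔼 => (r, y))).mul
      hη).aestronglyMeasurable
  · refine Eventually.of_forall fun y s hs => ?_
    rw [norm_mul]
    by_cases hy : y ∈ tsupport η
    · exact mul_le_mul_of_nonneg_right (hC (s, y) ⟨hs, hy⟩) (norm_nonneg _)
    · simp [image_eq_zero_of_notMem_tsupport hy]
  · exact (hη.norm.integrable_of_hasCompactSupport hc.norm).const_mul C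
  · refine Eventually.of_forall fun y s _ => ?_
    have h1 : HasDerivAt (fun s : ℝ => x + s • y) y s := by
      simpa using ((hasDerivAt_id s).smul_const y).const_add x
    exact (((hp.differentiable (by simp)).differentiableAt.hasFDerivAt).comp_hasDerivAt s
      h1).mul_const _

theorem dirDeriv_comp_dilation {f : 𝔼 → ℝ} (hf : ContDiff ℝ ∞ f) (x : 𝔼) (r : ℝ) (v : 𝔼) :
    dirDeriv v (fun y => f (x + r • y)) = fun y => r * dirDeriv v f (x + r • y) := by
  funext y
  have h1 : HasFDerivAt (fun y : 𝔼 => x + r • y) (r • ContinuousLinearMap.id ℝ 𝔼) y :=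
    ((hasFDerivAt_id y).const_smul r).const_add x
  have h2 := ((hf.differentiable (by simp)).differentiableAt.hasFDerivAt).comp y h1
  have h3 : HasFDerivAt (fun y => f (x + r • y)) _ y := h2
  rw [dirDeriv, h3.fderiv]
  simp [dirDeriv]

theorem contDiff_comp_dilation {f : 𝔼 → ℝ} (hf : ContDiff ℝ ∞ f) (x : 𝔼) (r : ℝ) :
    ContDiff ℝ ∞ fun y => f (x + r • y) :=
  hf.comp (by fun_prop)

/-- The radial derivative of a dilated average is a dilated average of the Laplacian. -/
theorem integral_fderiv_dilation_mul_kernel {p η Φ : 𝔼 → ℝ} (hp : ContDiff ℝ ∞ p)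
    (hΦ : ContDiff ℝ ∞ Φ) (hΦc : HasCompactSupport Φ)
    (hgrad : ∀ y v, dirDeriv v Φ y = η y * inner ℝ y v) (x : 𝔼) (r : ℝ) :
    ∫ y, fderiv ℝ p (x + r • y) y * η y = -(r * ∫ y, coordLaplacian p (x + r • y) * Φ y) := by
  have hD : ∀ i : Fin d, ContDiff ℝ ∞ (dirDeriv (EuclideanSpace.single i (1 : ℝ)) p) :=
    fun i => contDiff_dirDeriv hp _
  -- Since η(y) y = ∇Φ(y), the radial derivative becomes ∇p · ∇Φ, ready for integration by parts.
  have h1 : ∀ y, fderiv ℝ p (x + r • y) y * η y = ∑ i : Fin d,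
      dirDeriv (EuclideanSpace.single i (1 : ℝ)) p (x + r • y) *
        dirDeriv (EuclideanSpace.single i 1) Φ y := by
    intro y
    rw [fderiv_apply_eq_sum, Finset.sum_mul]
    refine Finset.sum_congr rfl fun i _ => ?_
    rw [hgrad]
    simp [dirDeriv, EuclideanSpace.inner_single_right]
    ring
  have hI : ∀ i : Fin d, Integrable fun y =>
      dirDeriv (EuclideanSpace.single i (1 : ℝ)) p (x + r • y) *
        dirDeriv (EuclideanSpace.single i 1) Φ y := fun i =>
    ((contDiff_comp_dilation (hD i) x r).continuous.mul
      (contDiff_dirDeriv hΦ _).continuous).integrable_of_hasCompactSupport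
      (hasCompactSupport_dirDeriv hΦc _).mul_left
  have hJ : ∀ i : Fin d, Integrable fun y => dirDeriv (EuclideanSpace.single i (1 : ℝ))
      (dirDeriv (EuclideanSpace.single i (1 : ℝ)) p) (x + r • y) * Φ y := fun i =>
    ((contDiff_comp_dilation (contDiff_dirDeriv (hD i) _) x r).continuous.mul
      hΦ.continuous).integrable_of_hasCompactSupport hΦc.mul_left
  simp_rw [h1, coordLaplacian, Finset.sum_mul]
  rw [integral_finsetSum _ fun i _ => hI i, integral_finsetSum _ fun i _ => hJ i,
    Finset.mul_sum, ← Finset.sum_neg_distrib]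
  refine Finset.sum_congr rfl fun i _ => ?_
  rw [integral_mul_dirDeriv (contDiff_comp_dilation (hD i) x r) hΦ hΦc,
    dirDeriv_comp_dilation (hD i)]
  simp_rw [mul_assoc]
  rw [integral_const_mul]

theorem norm_dirDeriv_le (f : 𝔼 → ℝ) {v : 𝔼} (hv : ‖v‖ ≤ 1) (y : 𝔼) :
    ‖dirDeriv v f y‖ ≤ ‖fderiv ℝ f y‖ :=
  ((fderiv ℝ f y).le_opNorm v).trans (mul_le_of_le_one_right (norm_nonneg _) hv)

/-- A bound for `r ∫ ∂_v f (x + r y) η(y) dy` by the maximum of `f`. -/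
theorem abs_mul_integral_dirDeriv_dilation_le {f η : 𝔼 → ℝ} (hf : ContDiff ℝ ∞ f)
    (hη : ContDiff ℝ ∞ η) (hηs : tsupport η ⊆ Metric.closedBall 0 1)
    {x : 𝔼} {ρ M : ℝ} (hM : ∀ y ∈ Metric.closedBall x ρ, |f y| ≤ M)
    {r : ℝ} (hr0 : 0 ≤ r) (hr : r ≤ ρ) {v : 𝔼} (hv : ‖v‖ ≤ 1) :
    |r * ∫ y, dirDeriv v f (x + r • y) * η y| ≤ M * ∫ y, ‖fderiv ℝ η y‖ := by
  have hηc : HasCompactSupport η :=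
    (isCompact_closedBall _ _).of_isClosed_subset (isClosed_tsupport _) hηs
  -- The prefactor r is the chain-rule factor of y ↦ f (x + r y), so the derivative can be moved
  -- onto η at no cost in r.
  have h1 : r * ∫ y, dirDeriv v f (x + r • y) * η y = -∫ y, f (x + r • y) * dirDeriv v η y := by
    rw [integral_mul_dirDeriv (contDiff_comp_dilation hf x r) hη hηc,
      dirDeriv_comp_dilation hf, neg_neg, ← integral_const_mul]
    simp_rw [mul_assoc]
  rw [h1, abs_neg, ← integral_const_mul, ← Real.norm_eq_abs]
  have hint : Integrable fun y => ‖fderiv ℝ η y‖ :=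
    ((hη.continuous_fderiv (by simp)).norm).integrable_of_hasCompactSupport (hηc.fderiv ℝ).norm
  refine norm_integral_le_of_norm_le (hint.const_mul M) (Eventually.of_forall fun y => ?_)
  rw [norm_mul]
  by_cases hy : y ∈ tsupport η
  · have hy1 : ‖y‖ ≤ 1 := by simpa using hηs hy
    have hmem : x + r • y ∈ Metric.closedBall x ρ := by
      rw [mem_closedBall_iff_norm, add_sub_cancel_left, norm_smul, Real.norm_of_nonneg hr0]
      exact (mul_le_of_le_one_right hr0 hy1).trans hr
    have := hM _ hmem
    exact mul_le_mul this (norm_dirDeriv_le η hv y) (norm_nonneg _) ((abs_nonneg _).trans this)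
  · have : y ∉ tsupport (fderiv ℝ η) := fun h => hy (tsupport_fderiv_subset ℝ h)
    simp [dirDeriv, image_eq_zero_of_notMem_tsupport this]

/-- If `Δf = -λ f` on an open set, so do all directional derivatives. -/
theorem coordLaplacian_dirDeriv_eq {f : 𝔼 → ℝ} (hf : ContDiff ℝ ∞ f) {U : Set 𝔼} (hU : IsOpen U)
    {l : ℝ} (h : ∀ y ∈ U, coordLaplacian f y = -(l * f y)) (v : 𝔼) :
    ∀ y ∈ U, coordLaplacian (dirDeriv v f) y = -(l * dirDeriv v f y) := by
  intro y hy
  rw [coordLaplacian_dirDeriv hf]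
  have : coordLaplacian f =ᶠ[𝓝 y] fun z => (-l) * f z := by
    filter_upwards [hU.mem_nhds hy] with z hz
    rw [h z hz]; ring
  have hd : DifferentiableAt ℝ f y := (hf.differentiable (by simp)).differentiableAt
  rw [dirDeriv, this.fderiv_eq, fderiv_const_mul hd]
  simp [dirDeriv]

/-- Interior gradient estimate for smooth solutions of `Δf = -λ f`. -/
theorem exists_gradient_estimate (d : ℕ) (l : ℝ) : ∃ C : ℝ, 1 ≤ C ∧
    ∀ (f : EuclideanSpace ℝ (Fin d) → ℝ) (U : Set (EuclideanSpace ℝ (Fin d))), ContDiff ℝ ∞ f →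
      IsOpen U → (∀ y ∈ U, coordLaplacian f y = -(l * f y)) →
      ∀ (x : EuclideanSpace ℝ (Fin d)) (ρ M : ℝ), 0 < ρ → ρ ≤ 1 → Metric.closedBall x ρ ⊆ U →
        (∀ y ∈ Metric.closedBall x ρ, |f y| ≤ M) →
        ∀ v : EuclideanSpace ℝ (Fin d), ‖v‖ ≤ 1 → |dirDeriv v f x| ≤ C / ρ * M := by
  obtain ⟨η, Φ, hη, hΦ, hηs, hΦs, hgrad, hmass⟩ := exists_radial_kernel d
  have hηc : HasCompactSupport η :=
    (isCompact_closedBall _ _).of_isClosed_subset (isClosed_tsupport _) hηs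
  have hΦc : HasCompactSupport Φ :=
    (isCompact_closedBall _ _).of_isClosed_subset (isClosed_tsupport _) hΦs
  set K₁ := ∫ y, ‖fderiv ℝ η y‖
  set K₂ := ∫ y, ‖fderiv ℝ Φ y‖
  have hK₁ : 0 ≤ K₁ := integral_nonneg fun _ => norm_nonneg _
  have hK₂ : 0 ≤ K₂ := integral_nonneg fun _ => norm_nonneg _
  -- K₁ comes from the average at radius ρ, |l| K₂ from the variation of the average; the summand 1
  -- only secures 1 ≤ C.
  refine ⟨K₁ + |l| * K₂ + 1, by nlinarith [mul_nonneg (abs_nonneg l) hK₂], ?_⟩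
  intro f U hf hU heq x ρ M hρ hρ1 hball hM v hv
  have hM0 : 0 ≤ M := (abs_nonneg _).trans (hM x (Metric.mem_closedBall_self hρ.le))
  have hp := contDiff_dirDeriv hf v
  set p := dirDeriv v f with hpdef
  have hpeq := coordLaplacian_dirDeriv_eq hf hU heq v
  -- A is the dilated average of p = ∂_v f, with A 0 = p x. As p solves the same equation near x, A′
  -- is l r times an average of p against Φ for 0 ≤ r < ρ. Moving ∂_v onto the kernels bounds A ρ
  -- and A′ by M alone, without any bound on p.
  let A : ℝ → ℝ := fun r => ∫ y, p (x + r • y) * η y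
  have hA : ∀ r, HasDerivAt A (-(r * ∫ y, coordLaplacian p (x + r • y) * Φ y)) r := by
    intro r
    have := hasDerivAt_integral_dilation hp hη.continuous hηc x r
    rwa [integral_fderiv_dilation_mul_kernel hp hΦ hΦc hgrad] at this
  have hbound : ∀ r ∈ Ico 0 ρ, ‖-(r * ∫ y, coordLaplacian p (x + r • y) * Φ y)‖
      ≤ |l| * (M * K₂) := by
    intro r hr
    have h1 : ∀ y, coordLaplacian p (x + r • y) * Φ y = -l * (p (x + r • y) * Φ y) := by
      intro y
      by_cases hy : y ∈ tsupport Φ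
      · have hy1 : ‖y‖ ≤ 1 := by simpa using hΦs hy
        have hmem : x + r • y ∈ Metric.closedBall x ρ := by
          rw [mem_closedBall_iff_norm, add_sub_cancel_left, norm_smul, Real.norm_of_nonneg hr.1]
          exact (mul_le_of_le_one_right hr.1 hy1).trans hr.2.le
        rw [hpeq _ (hball hmem)]
        ring
      · simp [image_eq_zero_of_notMem_tsupport hy]
    simp_rw [h1]
    rw [integral_const_mul, norm_neg, mul_left_comm, norm_mul, norm_neg, Real.norm_eq_abs]
    exact mul_le_mul_of_nonneg_left
      (abs_mul_integral_dirDeriv_dilation_le hf hΦ hΦs hM hr.1 hr.2.le hv) (abs_nonneg _)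
  have hmv := norm_image_sub_le_of_norm_deriv_le_segment' (fun r _ => (hA r).hasDerivWithinAt)
    hbound ρ (right_mem_Icc.2 hρ.le)
  have hA0 : A 0 = p x := by
    simp only [A, zero_smul, add_zero]
    rw [integral_const_mul, hmass, mul_one]
  have hAρ := abs_mul_integral_dirDeriv_dilation_le hf hη hηs hM hρ.le le_rfl hv
  rw [abs_mul, abs_of_pos hρ] at hAρ
  change ρ * |A ρ| ≤ M * K₁ at hAρ
  rw [hA0, Real.norm_eq_abs, sub_zero] at hmv
  have htri : |p x| ≤ |A ρ| + |A ρ - p x| := by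
    have := abs_sub_abs_le_abs_sub (p x) (A ρ)
    rw [abs_sub_comm] at this
    linarith
  rw [div_mul_eq_mul_div, le_div_iff₀ hρ]
  have hlK : 0 ≤ |l| * (M * K₂) := by positivity
  have hρ2 : ρ * ρ ≤ 1 := by nlinarith
  calc |p x| * ρ ≤ (|A ρ| + |l| * (M * K₂) * ρ) * ρ := by gcongr; exact htri.trans (by gcongr)
    _ = ρ * |A ρ| + |l| * (M * K₂) * (ρ * ρ) := by ring
    _ ≤ M * K₁ + |l| * (M * K₂) * 1 := by gcongr
    _ ≤ (K₁ + |l| * K₂ + 1) * M := by linarith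

/-! ### Higher derivatives and local unique continuation for smooth solutions -/

/-- Interior estimate for higher derivatives, by iterating the gradient estimate. -/
theorem abs_iterate_dirDeriv_le {l C : ℝ} (hC : ∀ (f : 𝔼 → ℝ) (U : Set 𝔼), ContDiff ℝ ∞ f →
      IsOpen U → (∀ y ∈ U, coordLaplacian f y = -(l * f y)) →
      ∀ (x : 𝔼) (ρ M : ℝ), 0 < ρ → ρ ≤ 1 → Metric.closedBall x ρ ⊆ U →
        (∀ y ∈ Metric.closedBall x ρ, |f y| ≤ M) →
        ∀ v : 𝔼, ‖v‖ ≤ 1 → |dirDeriv v f x| ≤ C / ρ * M)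
    {U : Set 𝔼} (hU : IsOpen U) {x₀ : 𝔼} {R ρ : ℝ} (hρ : 0 < ρ) (hρ1 : ρ ≤ 1)
    {v : 𝔼} (hv : ‖v‖ ≤ 1) (k : ℕ) : ∀ (f : 𝔼 → ℝ) (M : ℝ), ContDiff ℝ ∞ f →
      (∀ y ∈ U, coordLaplacian f y = -(l * f y)) → Metric.closedBall x₀ (R + k * ρ) ⊆ U →
      (∀ y ∈ Metric.closedBall x₀ (R + k * ρ), |f y| ≤ M) →
      ∀ x ∈ Metric.closedBall x₀ R, |(dirDeriv v)^[k] f x| ≤ (C / ρ) ^ k * M := by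
  induction k with
  | zero => intro f M _ _ _ hM x hx; simpa using hM x (by simpa using hx)
  | succ k ih =>
    intro f M hf heq hball hM x hx
    -- Each derivative costs one shell of width ρ: `dirDeriv v f` is bounded by C/ρ · M on the ball
    -- with one shell fewer, where the induction hypothesis applies to it.
    have hsub : ∀ y ∈ Metric.closedBall x₀ (R + k * ρ),
        Metric.closedBall y ρ ⊆ Metric.closedBall x₀ (R + (k + 1 : ℕ) * ρ) := fun y hy =>
      Metric.closedBall_subset_closedBall' (by
        rw [Metric.mem_closedBall] at hy; push_cast; linarith)
    have := ih (dirDeriv v f) (C / ρ * M) (contDiff_dirDeriv hf v)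
      (coordLaplacian_dirDeriv_eq hf hU heq v)
      ((Metric.closedBall_subset_closedBall (by push_cast; linarith)).trans hball)
      (fun y hy => hC f U hf hU heq y ρ M hρ hρ1 ((hsub y hy).trans hball)
        (fun z hz => hM z (hsub y hy hz)) v hv) x hx
    rw [Function.iterate_succ_apply, pow_succ, mul_assoc]
    exact this

/-- A Taylor bound: if `h 0` has vanishing derivatives `h j` at `0`, then it is controlled by its
`k`-th derivative. -/
theorem abs_le_of_iterated_hasDerivAt (k : ℕ) : ∀ (h : ℕ → ℝ → ℝ) (B T : ℝ),
    (∀ j s, HasDerivAt (h j) (h (j + 1) s) s) → (∀ j, h j 0 = 0) →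
    (∀ s ∈ Icc 0 T, |h k s| ≤ B) → ∀ s ∈ Icc 0 T, |h 0 s| ≤ B * s ^ k / k.factorial := by
  induction k with
  | zero => intro h B T _ _ hB s hs; simpa using hB s hs
  | succ k ih =>
    intro h B T hd h0 hB s hs
    have ih' := ih (fun j => h (j + 1)) B T (fun j => hd (j + 1)) (fun j => h0 (j + 1)) hB
    -- The induction hypothesis for the shifted family bounds |h 1| by the derivative of the claimed
    -- majorant of |h 0|.
    refine image_norm_le_of_norm_deriv_right_le_deriv_boundary (f := h 0) (f' := h 1)
      (B := fun s => B * s ^ (k + 1) / (k + 1).factorial)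
      (B' := fun s => B * s ^ k / k.factorial)
      (fun s _ => (hd 0 s).continuousAt.continuousWithinAt)
      (fun s _ => (hd 0 s).hasDerivWithinAt) (by simp [h0]) (fun s => ?_)
      (fun s hs => ih' s ⟨hs.1, hs.2.le⟩) hs
    have h1 := ((hasDerivAt_pow (k + 1) s).const_mul B).div_const ((k + 1).factorial : ℝ)
    have e : B * s ^ k / k.factorial = B * ((k + 1 : ℕ) * s ^ (k + 1 - 1)) / (k + 1).factorial := by
      rw [Nat.factorial_succ, Nat.add_sub_cancel]
      push_cast
      field_simp
    rw [e]
    exact h1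

/-- Local unique continuation for smooth solutions of `Δf = -λ f`, in balls whose radius does not
depend on the solution. -/
theorem exists_radius_unique_continuation (d : ℕ) (l : ℝ) : ∃ c : ℝ, 0 < c ∧ c ≤ 1 ∧
    ∀ (f : EuclideanSpace ℝ (Fin d) → ℝ) (U : Set (EuclideanSpace ℝ (Fin d))), ContDiff ℝ ∞ f →
      IsOpen U → (∀ y ∈ U, coordLaplacian f y = -(l * f y)) →
      ∀ (x₀ : EuclideanSpace ℝ (Fin d)) (R : ℝ), 0 < R → R ≤ 1 →
        Metric.closedBall x₀ (2 * R) ⊆ U → f =ᶠ[𝓝 x₀] 0 →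
        ∀ x ∈ Metric.closedBall x₀ (c * R), f x = 0 := by
  obtain ⟨C, hC1, hC⟩ := exists_gradient_estimate d l
  have he : 1 ≤ Real.exp 1 := Real.one_le_exp zero_le_one
  have hCe : 1 ≤ C * Real.exp 1 := one_le_mul_of_one_le_of_one_le hC1 he
  -- For t ≤ c R this choice gives C e t / R ≤ 1/2, the ratio of the geometric bound below.
  refine ⟨1 / (2 * (C * Real.exp 1)), by positivity, ?_, ?_⟩
  · rw [div_le_one (by positivity)]; linarith
  intro f U hf hU heq x₀ R hR hR1 hball h0 x hx
  obtain ⟨M, hM⟩ := (isCompact_closedBall x₀ (2 * R)).exists_bound_of_continuousOn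
    hf.continuous.continuousOn
  rw [mem_closedBall_iff_norm] at hx
  rcases eq_or_ne x x₀ with rfl | hne
  · exact h0.self_of_nhds
  have ht0 : 0 < ‖x - x₀‖ := norm_pos_iff.2 (sub_ne_zero.2 hne)
  set t := ‖x - x₀‖ with ht
  set v : EuclideanSpace ℝ (Fin d) := t⁻¹ • (x - x₀) with hvdef
  have hv : ‖v‖ = 1 := by
    rw [hvdef, norm_smul, ← ht, norm_inv, Real.norm_of_nonneg ht0.le, inv_mul_cancel₀ ht0.ne']
  have htv : x₀ + t • v = x := by
    rw [hvdef, smul_inv_smul₀ ht0.ne', add_sub_cancel]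
  have htR : t * (2 * (C * Real.exp 1)) ≤ R := by
    have := hx
    rw [div_mul_eq_mul_div, one_mul, le_div_iff₀ (by positivity)] at this
    exact this
  have htR' : t ≤ R := by nlinarith
  have hvan : ∀ j, (dirDeriv v)^[j] f =ᶠ[𝓝 x₀] 0 := by
    intro j
    induction j with
    | zero => exact h0
    | succ j ih =>
      rw [Function.iterate_succ_apply']
      filter_upwards [ih.fderiv (𝕜 := ℝ)] with y hy
      simp [dirDeriv, hy]
  have hkey : ∀ k : ℕ, 0 < k → |f x| ≤ M * (1 / 2) ^ k := by
    intro k hk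
    have hk' : (0 : ℝ) < k := by exact_mod_cast hk
    have hk1 : (1 : ℝ) ≤ k := by exact_mod_cast hk
    have hkR : R + k * (R / k) = 2 * R := by field_simp; ring
    have hM0 : 0 ≤ M := (norm_nonneg _).trans (hM x₀ (Metric.mem_closedBall_self (by positivity)))
    -- With ρ = R/k, the k shells exactly fill the gap between the radii R and 2R.
    have hest := abs_iterate_dirDeriv_le (ρ := R / k) hC hU (x₀ := x₀) (R := R) (by positivity)
      ((div_le_self hR.le hk1).trans hR1) hv.le k f M hf heq (by rwa [hkR])
      (by rw [hkR]; exact hM)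
    have htay := abs_le_of_iterated_hasDerivAt k
      (fun j s => (dirDeriv v)^[j] f (x₀ + s • v)) ((C / (R / k)) ^ k * M) t
      (fun j s => by
        have h1 : HasDerivAt (fun s : ℝ => x₀ + s • v) v s := by
          simpa using ((hasDerivAt_id s).smul_const v).const_add x₀
        have h2 := (((contDiff_iterate_dirDeriv hf v j).differentiable
          (by simp)).differentiableAt (x := x₀ + s • v)).hasFDerivAt.comp_hasDerivAt s h1
        rw [Function.iterate_succ_apply']
        exact h2)
      (fun j => by simpa using (hvan j).self_of_nhds)
      (fun s hs => hest _ (by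
        rw [mem_closedBall_iff_norm, add_sub_cancel_left, norm_smul, hv, mul_one,
          Real.norm_of_nonneg hs.1]
        exact hs.2.trans htR'))
      t (right_mem_Icc.2 ht0.le)
    simp only [Function.iterate_zero, id_eq, htv] at htay
    have hexp : (k : ℝ) ^ k / k.factorial ≤ Real.exp 1 ^ k := by
      have := Real.pow_div_factorial_le_exp k hk'.le k
      rwa [← Real.exp_one_pow] at this
    calc |f x| ≤ (C / (R / k)) ^ k * M * t ^ k / k.factorial := htay
      _ = M * (C * t / R) ^ k * ((k : ℝ) ^ k / k.factorial) := by
        rw [div_pow, div_pow, div_pow, mul_pow]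
        field_simp
      _ ≤ M * (C * t / R) ^ k * Real.exp 1 ^ k := by gcongr
      _ = M * (C * t * Real.exp 1 / R) ^ k := by
        rw [mul_assoc, ← mul_pow]; congr 2; ring
      _ ≤ M * (1 / 2) ^ k := by
        refine mul_le_mul_of_nonneg_left (pow_le_pow_left₀ (by positivity) ?_ k) hM0
        rw [div_le_div_iff₀ hR two_pos]
        linarith
  have hlim : Tendsto (fun k : ℕ => M * (1 / 2 : ℝ) ^ k) atTop (𝓝 0) := by
    simpa using (tendsto_pow_atTop_nhds_zero_of_lt_one (r := (1 / 2 : ℝ)) (by norm_num)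
      (by norm_num)).const_mul M
  have : |f x| ≤ 0 := ge_of_tendsto hlim ((eventually_gt_atTop 0).mono hkey)
  exact abs_nonpos_iff.1 this

/-! ### Distributional solutions, mollification and unique continuation -/

/-- `w` is a distributional solution of `Δw = -λ w` in `Ω`. -/
def IsDistribSolution (Ω : Set (EuclideanSpace ℝ (Fin d))) (l : ℝ)
    (w : EuclideanSpace ℝ (Fin d) → ℝ) : Prop :=
  ∀ φ : EuclideanSpace ℝ (Fin d) → ℝ, ContDiff ℝ ∞ φ → HasCompactSupport φ → tsupport φ ⊆ Ω →
    ∫ x, (coordLaplacian φ x + l * φ x) * w x = 0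

theorem dirDeriv_convolution {ψ w : 𝔼 → ℝ} (hψ : ContDiff ℝ ∞ ψ) (hc : HasCompactSupport ψ)
    (hw : LocallyIntegrable w) (v : 𝔼) :
    dirDeriv v (fun x => ∫ t, ψ t * w (x - t)) = fun x => ∫ t, dirDeriv v ψ t * w (x - t) := by
  funext x
  have h := hc.hasFDerivAt_convolution_left (ContinuousLinearMap.lsmul ℝ ℝ)
    (contDiff_infty.1 hψ 1) hw x
  have h' : HasFDerivAt (fun x => ∫ t, ψ t * w (x - t)) _ x := h
  rw [dirDeriv, h'.fderiv, convolution_def, ContinuousLinearMap.integral_apply]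
  · simp [dirDeriv, ContinuousLinearMap.precompL_apply]
  · exact (hc.fderiv ℝ).convolutionExists_left _
      (hψ.continuous_fderiv (by simp)) hw x

theorem contDiff_integral_mul_sub {ψ w : 𝔼 → ℝ} (hψ : ContDiff ℝ ∞ ψ) (hc : HasCompactSupport ψ)
    (hw : LocallyIntegrable w) : ContDiff ℝ ∞ (fun x => ∫ t, ψ t * w (x - t)) :=
  hc.contDiff_convolution_left (ContinuousLinearMap.lsmul ℝ ℝ) hψ hw

theorem integrable_mul_comp_sub {ψ w : 𝔼 → ℝ} (hψ : Continuous ψ) (hc : HasCompactSupport ψ)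
    (hw : LocallyIntegrable w) (x : 𝔼) : Integrable fun t => ψ t * w (x - t) :=
  hc.convolutionExists_left (ContinuousLinearMap.lsmul ℝ ℝ) hψ hw x

theorem hasCompactSupport_coordLaplacian {f : 𝔼 → ℝ} (hf : HasCompactSupport f) :
    HasCompactSupport (coordLaplacian f) := by
  refine HasCompactSupport.intro hf fun x hx => Finset.sum_eq_zero fun i _ => ?_
  exact image_eq_zero_of_notMem_tsupport fun h =>
    hx (tsupport_dirDeriv_subset _ _ (tsupport_dirDeriv_subset _ _ h))

theorem coordLaplacian_convolution {ψ w : 𝔼 → ℝ} (hψ : ContDiff ℝ ∞ ψ)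
    (hc : HasCompactSupport ψ) (hw : LocallyIntegrable w) :
    coordLaplacian (fun x => ∫ t, ψ t * w (x - t)) =
      fun x => ∫ t, coordLaplacian ψ t * w (x - t) := by
  funext x
  simp_rw [coordLaplacian, dirDeriv_convolution hψ hc hw,
    dirDeriv_convolution (contDiff_dirDeriv hψ _) (hasCompactSupport_dirDeriv hc _) hw,
    Finset.sum_mul]
  rw [integral_finsetSum]
  exact fun i _ => integrable_mul_comp_sub
    (contDiff_dirDeriv (contDiff_dirDeriv hψ _) _).continuous
    (hasCompactSupport_dirDeriv (hasCompactSupport_dirDeriv hc _) _) hw x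

theorem dirDeriv_comp_const_sub {f : 𝔼 → ℝ} (hf : ContDiff ℝ ∞ f) (x v : 𝔼) :
    dirDeriv v (fun y => f (x - y)) = fun y => -dirDeriv v f (x - y) := by
  funext y
  have h1 : HasFDerivAt (fun y : 𝔼 => x - y) (-ContinuousLinearMap.id ℝ 𝔼) y :=
    (hasFDerivAt_id y).const_sub x
  have h3 : HasFDerivAt (fun y => f (x - y)) _ y :=
    ((hf.differentiable (by simp)).differentiableAt.hasFDerivAt).comp y h1
  rw [dirDeriv, h3.fderiv]
  simp [dirDeriv]

/-- The two signs from the reflection cancel. -/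
theorem coordLaplacian_comp_const_sub {f : 𝔼 → ℝ} (hf : ContDiff ℝ ∞ f) (x : 𝔼) :
    coordLaplacian (fun y => f (x - y)) = fun y => coordLaplacian f (x - y) := by
  funext y
  refine Finset.sum_congr rfl fun i _ => ?_
  rw [dirDeriv_comp_const_sub hf]
  have h := congrFun (dirDeriv_comp_const_sub
    (contDiff_dirDeriv hf (EuclideanSpace.single i 1)) x (EuclideanSpace.single i 1)) y
  unfold dirDeriv at h ⊢
  rw [fderiv_fun_neg]
  simp [h]

/-- Mollifying a distributional solution yields a classical solution, away from the boundary. -/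
theorem IsDistribSolution.coordLaplacian_mollify {Ω : Set 𝔼} {l : ℝ} {w : 𝔼 → ℝ}
    (hsol : IsDistribSolution Ω l w) (hw : LocallyIntegrable w) {ψ : 𝔼 → ℝ}
    (hψ : ContDiff ℝ ∞ ψ) {ε : ℝ} (hs : tsupport ψ ⊆ Metric.closedBall 0 ε) {x : 𝔼}
    (hx : Metric.closedBall x ε ⊆ Ω) :
    coordLaplacian (fun x => ∫ t, ψ t * w (x - t)) x = -(l * ∫ t, ψ t * w (x - t)) := by
  have hc : HasCompactSupport ψ :=
    (isCompact_closedBall _ _).of_isClosed_subset (isClosed_tsupport _) hs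
  have hsupp : tsupport (fun y => ψ (x - y)) ⊆ Metric.closedBall x ε := by
    refine closure_minimal (fun y hy => ?_) Metric.isClosed_closedBall
    have := hs (subset_tsupport _ hy)
    rwa [mem_closedBall_zero_iff, ← mem_closedBall_iff_norm'] at this
  -- The equation is tested with the reflected kernel centred at x; the substitution y ↦ x - y then
  -- produces the convolutions.
  have h := hsol (fun y => ψ (x - y)) (hψ.comp (by fun_prop))
    ((isCompact_closedBall _ _).of_isClosed_subset (isClosed_tsupport _) hsupp)
    (hsupp.trans hx)
  rw [coordLaplacian_comp_const_sub hψ, ← integral_sub_left_eq_self _ volume x] at h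
  simp only [sub_sub_cancel, add_mul, mul_assoc] at h
  rw [integral_add, integral_const_mul] at h
  · rw [coordLaplacian_convolution hψ hc hw]
    linarith
  · exact integrable_mul_comp_sub (contDiff_coordLaplacian hψ).continuous
      (hasCompactSupport_coordLaplacian hc) hw x
  · exact (integrable_mul_comp_sub hψ.continuous hc hw x).const_mul l

/-- Local unique continuation for distributional solutions. -/
theorem IsDistribSolution.ae_eq_zero_ball {Ω : Set 𝔼} {l c : ℝ}
    (hc : ∀ (f : 𝔼 → ℝ) (U : Set 𝔼), ContDiff ℝ ∞ f →
      IsOpen U → (∀ y ∈ U, coordLaplacian f y = -(l * f y)) →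
      ∀ (x₀ : 𝔼) (R : ℝ), 0 < R → R ≤ 1 →
        Metric.closedBall x₀ (2 * R) ⊆ U → f =ᶠ[𝓝 x₀] 0 →
        ∀ x ∈ Metric.closedBall x₀ (c * R), f x = 0)
    {w : 𝔼 → ℝ} (hsol : IsDistribSolution Ω l w) (hw : LocallyIntegrable w)
    {x₀ : 𝔼} {R r : ℝ} (hR : 0 < R) (hR1 : R ≤ 1) (hr : 0 < r)
    (hball : Metric.ball x₀ (4 * R) ⊆ Ω) (h0 : ∀ᵐ x, x ∈ Metric.ball x₀ r → w x = 0) :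
    ∀ᵐ x, x ∈ Metric.closedBall x₀ (c * R) → w x = 0 := by
  let b : ℕ → ContDiffBump (0 : 𝔼) := fun n =>
    ⟨1 / (n + 1) / 2, 1 / (n + 1), by positivity, half_lt_self (by positivity)⟩
  have hb : Tendsto (fun n => (b n).rOut) atTop (𝓝 0) := tendsto_one_div_add_atTop_nhds_zero_nat
  -- The mollifications converge to w a.e.; K = 2 is the ratio of outer to inner radius of the
  -- bumps.
  have hconv := ContDiffBump.ae_convolution_tendsto_right_of_locallyIntegrable (μ := volume)
    (K := 2) hb (Eventually.of_forall fun n => by simp only [b]; linarith) hw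
  filter_upwards [hconv] with x hx hmem
  refine tendsto_nhds_unique hx (tendsto_const_nhds.congr' ?_)
  -- Outer radius below R makes the mollification a classical solution on the ball of radius 3R;
  -- below r/2 it makes it vanish on the ball of radius r/2. The constant c is the same for every n.
  filter_upwards [hb.eventually_lt_const hR, hb.eventually_lt_const (half_pos hr)] with n hn hn'
  have hψs : tsupport ((b n).normed volume) ⊆ Metric.closedBall 0 (b n).rOut :=
    ((b n).tsupport_normed_eq).subset
  have hψ : ContDiff ℝ ∞ ((b n).normed volume) := (b n).contDiff_normed
  refine (hc (fun x => ∫ t, (b n).normed volume t * w (x - t)) (Metric.ball x₀ (3 * R))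
    (contDiff_integral_mul_sub hψ (b n).hasCompactSupport_normed hw) Metric.isOpen_ball
    (fun y hy => hsol.coordLaplacian_mollify hw hψ hψs ?_) x₀ R hR hR1 ?_ ?_ x hmem).symm
  · refine Subset.trans (fun z hz => ?_) hball
    rw [Metric.mem_ball] at hy ⊢
    rw [Metric.mem_closedBall] at hz
    linarith [dist_triangle z y x₀]
  · exact Metric.closedBall_subset_ball (by linarith)
  · filter_upwards [Metric.ball_mem_nhds x₀ (half_pos hr)] with y hy
    refine integral_eq_zero_of_ae ?_
    have h0' : ∀ᵐ t, y - t ∈ Metric.ball x₀ r → w (y - t) = 0 :=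
      (Measure.measurePreserving_sub_left volume y).quasiMeasurePreserving.ae h0
    filter_upwards [h0'] with t ht
    by_cases hts : t ∈ tsupport ((b n).normed volume)
    · have h1 := hψs hts
      rw [mem_closedBall_zero_iff] at h1
      rw [mem_ball_iff_norm] at hy
      have : y - t ∈ Metric.ball x₀ r := by
        rw [mem_ball_iff_norm, sub_right_comm]
        linarith [norm_sub_le (y - x₀) t]
      simp [ht this]
    · simp [image_eq_zero_of_notMem_tsupport hts]

/-- Unique continuation: a distributional solution of `Δw = -λ w` on a connected open set which
vanishes on a nonempty open subset vanishes identically. -/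
theorem IsDistribSolution.ae_eq_zero {Ω : Set 𝔼} {l : ℝ} (hΩ : IsOpen Ω)
    (hconn : IsPreconnected Ω) {w : 𝔼 → ℝ} (hsol : IsDistribSolution Ω l w)
    (hw : LocallyIntegrable w) {P : Set 𝔼} (hP : IsOpen P) (hne : P.Nonempty) (hPΩ : P ⊆ Ω)
    (h0 : ∀ᵐ x, x ∈ P → w x = 0) : ∀ᵐ x, x ∈ Ω → w x = 0 := by
  obtain ⟨c, hc0, hc1, hc⟩ := exists_radius_unique_continuation d l
  let Z : Set 𝔼 := {x | ∃ r > 0, ∀ᵐ y, y ∈ Metric.ball x r → w y = 0}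
  have hZo : IsOpen Z := by
    refine Metric.isOpen_iff.2 fun x ⟨r, hr, h⟩ => ⟨r / 2, half_pos hr, fun y hy => ?_⟩
    refine ⟨r / 2, half_pos hr, h.mono fun z hz hzy => hz ?_⟩
    rw [Metric.mem_ball] at *
    linarith [dist_triangle z y x]
  have hΩZ : Ω ⊆ Z := by
    -- The set Z of points near which w = 0 a.e. is open and meets Ω; it remains to see that it is
    -- relatively closed in Ω.
    refine hconn.subset_of_closure_inter_subset hZo ?_ ?_
    · obtain ⟨p, hp⟩ := hne
      obtain ⟨r, hr, hrP⟩ := Metric.isOpen_iff.1 hP p hp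
      exact ⟨p, hPΩ hp, r, hr, h0.mono fun y hy hyr => hy (hrP hyr)⟩
    · rintro x ⟨hxZ, hxΩ⟩
      obtain ⟨s, hs, hsΩ⟩ := Metric.isOpen_iff.1 hΩ x hxΩ
      -- A nearby z ∈ Z lies within c R / 2 ≤ R of x, so the ball of radius 4R about z fits into the
      -- one of radius 5R ≤ s about x, while the ball of radius c R about z covers a neighbourhood
      -- of x.
      set R := min 1 (s / 5) with hRdef
      have hR : 0 < R := lt_min one_pos (by positivity)
      have hRs : 5 * R ≤ s := by linarith [min_le_right 1 (s / 5)]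
      obtain ⟨z, ⟨r, hr, hzr⟩, hxz⟩ := Metric.mem_closure_iff.1 hxZ (c * R / 2) (by positivity)
      have hcR : c * R ≤ R := mul_le_of_le_one_left hR.le hc1
      have hz := hsol.ae_eq_zero_ball hc hw hR (min_le_left _ _) hr (Subset.trans (fun y hy => by
        rw [Metric.mem_ball] at *
        rw [dist_comm] at hxz
        linarith [dist_triangle y z x]) hsΩ) hzr
      refine ⟨c * R / 2, by positivity, hz.mono fun y hy hyx => hy ?_⟩
      rw [Metric.mem_ball] at hyx
      rw [Metric.mem_closedBall]
      linarith [dist_triangle y x z]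
  have hnull : volume {x | x ∈ Ω ∧ w x ≠ 0} = 0 := by
    refine measure_null_of_locally_null _ fun x hx => ?_
    obtain ⟨r, hr, h⟩ := hΩZ hx.1
    refine ⟨Metric.ball x r ∩ {x | x ∈ Ω ∧ w x ≠ 0},
      inter_mem (mem_nhdsWithin_of_mem_nhds (Metric.ball_mem_nhds x hr)) self_mem_nhdsWithin, ?_⟩
    refine measure_mono_null (fun y hy => ?_) (ae_iff.1 h)
    exact fun hcon => hy.2.2 (hcon hy.1)
  rw [ae_iff]
  convert hnull using 3
  simp

/-! ### Finiteness of the surface measure -/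

/-- Near a boundary point the boundary of a region above a graph is contained in the graph. -/
theorem inner_eq_of_mem_frontier {Ω : Set 𝔼} (hΩ : IsOpen Ω) {e x : 𝔼} {γ : 𝔼 → ℝ}
    (hγ : Continuous γ) {r : ℝ}
    (h : ∀ y ∈ Metric.ball x r, (y ∈ Ω ↔ γ (y - (inner ℝ e y) • e) < inner ℝ e y)) {y : 𝔼}
    (hy : y ∈ frontier Ω) (hyr : y ∈ Metric.ball x r) :
    γ (y - (inner ℝ e y) • e) = inner ℝ e y := by
  rw [hΩ.frontier_eq] at hy
  refine le_antisymm ?_ (not_lt.1 fun hlt => hy.2 ((h y hyr).2 hlt))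
  by_contra! hlt
  have hopen : IsOpen {z : 𝔼 | inner ℝ e z < γ (z - (inner ℝ e z) • e)} :=
    isOpen_lt (by fun_prop) (by fun_prop)
  obtain ⟨z, hz, hzΩ⟩ := mem_closure_iff.1 hy.1 _ (hopen.inter Metric.isOpen_ball) ⟨hlt, hyr⟩
  exact lt_asymm hz.1 ((h z hz.2).1 hzΩ)

/-- A bounded piece of a Lipschitz graph over a hyperplane has finite surface measure. -/
theorem euclideanHausdorffMeasure_graph_lt_top (hd : 2 ≤ d) {e : 𝔼} (he : ‖e‖ = 1) {K : ℝ≥0}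
    {γ : 𝔼 → ℝ} (hγ : LipschitzWith K γ) (R : ℝ) :
    (Measure.euclideanHausdorffMeasure (d - 1) : Measure 𝔼)
      ((fun z : (ℝ ∙ e)ᗮ => (z : 𝔼) + γ z • e) '' Metric.closedBall 0 R) < ⊤ := by
  have hfr : Module.finrank ℝ (ℝ ∙ e)ᗮ = d - 1 := by
    have h1 := Submodule.finrank_add_finrank_orthogonal (ℝ ∙ e)
    rw [finrank_span_singleton (norm_ne_zero_iff.1 (he ▸ one_ne_zero)),
      finrank_euclideanSpace_fin] at h1
    omega
  have hγ' : LipschitzWith (K * 1) fun z : (ℝ ∙ e)ᗮ => γ z := hγ.comp (LipschitzWith.subtype_val _)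
  have hF : LipschitzWith (1 + K) fun z : (ℝ ∙ e)ᗮ => (z : 𝔼) + γ z • e := by
    refine LipschitzWith.of_dist_le_mul fun a b => ?_
    have h1 := hγ'.dist_le_mul a b
    rw [dist_eq_norm, add_sub_add_comm, ← sub_smul]
    refine (norm_add_le _ _).trans ?_
    rw [norm_smul, he, mul_one, ← dist_eq_norm, ← dist_eq_norm]
    push_cast at h1 ⊢
    rw [Subtype.dist_eq] at h1 ⊢
    linarith
  have h1 := hF.hausdorffMeasure_image_le (d := ((d - 1 : ℕ) : ℝ)) (Nat.cast_nonneg _)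
    (Metric.closedBall 0 R)
  -- On the (d-1)-dimensional space e^⊥ this Hausdorff measure is a Haar measure, hence finite on
  -- balls.
  have h2 : (μH[((d - 1 : ℕ) : ℝ)] : Measure (ℝ ∙ e)ᗮ) (Metric.closedBall 0 R) < ⊤ := by
    rw [← hfr]
    have := MeasureTheory.isAddHaarMeasure_hausdorffMeasure (E := (ℝ ∙ e)ᗮ)
    exact measure_closedBall_lt_top
  rw [Measure.euclideanHausdorffMeasure_def, Measure.smul_apply]
  exact ENNReal.mul_lt_top ENNReal.coe_lt_top (h1.trans_lt (ENNReal.mul_lt_top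
    (ENNReal.rpow_lt_top_of_nonneg (Nat.cast_nonneg _) ENNReal.coe_ne_top) h2))

/-- The boundary is compact and locally a bounded piece of a Lipschitz graph. Finiteness puts smooth
functions in L²(∂Ω) and makes L² data integrable. -/
theorem IsLipschitzDomain.isFiniteMeasure_surfaceMeasure (hd : 2 ≤ d) {Ω : Set 𝔼}
    (hΩ : IsLipschitzDomain Ω) : IsFiniteMeasure (surfaceMeasure Ω) := by
  have hcomp : IsCompact (frontier Ω) :=
    hΩ.isBounded.isCompact_closure.of_isClosed_subset isClosed_frontier frontier_subset_closure
  refine ⟨?_⟩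
  rw [surfaceMeasure, Measure.restrict_apply_univ]
  refine hcomp.measure_lt_top_of_nhdsWithin fun x hx => ?_
  obtain ⟨e, he, K, γ, hγ, r, hr, h⟩ := hΩ.locally_graph x hx
  refine ⟨Metric.ball x r ∩ frontier Ω,
    inter_mem (mem_nhdsWithin_of_mem_nhds (Metric.ball_mem_nhds x hr)) self_mem_nhdsWithin, ?_⟩
  -- The radius 2(‖x‖ + r) works since the component of y orthogonal to e has norm at most 2‖y‖.
  refine (measure_mono fun y hy => ?_).trans_lt
    (euclideanHausdorffMeasure_graph_lt_top hd he hγ (2 * (‖x‖ + r)))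
  have hy1 := inner_eq_of_mem_frontier hΩ.isOpen hγ.continuous h hy.2 hy.1
  have hmem : y - (inner ℝ e y) • e ∈ (ℝ ∙ e)ᗮ := by
    rw [Submodule.mem_orthogonal_singleton_iff_inner_right, inner_sub_right, inner_smul_right,
      real_inner_self_eq_norm_sq, he]
    simp
  refine ⟨⟨_, hmem⟩, ?_, ?_⟩
  · rw [mem_closedBall_zero_iff, Submodule.coe_norm]
    have h1 : ‖inner ℝ e y • e‖ ≤ ‖y‖ := by
      rw [norm_smul, he, mul_one]
      simpa [he] using norm_inner_le_norm (𝕜 := ℝ) e y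
    have h2 : ‖y‖ ≤ ‖x‖ + r := by
      have := mem_ball_iff_norm.1 hy.1
      linarith [norm_le_norm_add_norm_sub' y x]
    linarith [norm_sub_le y (inner ℝ e y • e)]
  · simp [hy1]

/-! ### Test functions, traces and the weak formulation -/

theorem continuous_gradient {φ : 𝔼 → ℝ} (hφ : ContDiff ℝ ∞ φ) : Continuous (∇ φ) :=
  (InnerProductSpace.toDual ℝ 𝔼).symm.continuous.comp (hφ.continuous_fderiv (by simp))

theorem _root_.Bornology.IsBounded.volume_restrict_isFiniteMeasure {Ω : Set 𝔼}
    (hb : Bornology.IsBounded Ω) : IsFiniteMeasure (volume.restrict Ω) :=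
  ⟨by simpa using hb.measure_lt_top⟩

theorem memLp_restrict_of_continuous {F : Type*} [NormedAddCommGroup F] [SecondCountableTopology F]
    {S K : Set 𝔼} (hK : IsCompact K) (hSK : S ⊆ K) (hS : MeasurableSet S) {μ : Measure 𝔼}
    [IsFiniteMeasure (μ.restrict S)] {f : 𝔼 → F} (hf : Continuous f) :
    MemLp f 2 (μ.restrict S) := by
  obtain ⟨C, hC⟩ := hK.exists_bound_of_continuousOn hf.continuousOn
  exact MemLp.of_bound hf.aestronglyMeasurable C
    ((ae_restrict_mem hS).mono fun x hx => hC x (hSK hx))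

theorem isSobolevH1_of_contDiff {Ω : Set 𝔼} (hΩ : IsOpen Ω) (hb : Bornology.IsBounded Ω)
    {φ : 𝔼 → ℝ} (hφ : ContDiff ℝ ∞ φ) : IsSobolevH1 Ω φ (∇ φ) := by
  have := hb.volume_restrict_isFiniteMeasure
  refine ⟨memLp_restrict_of_continuous hb.isCompact_closure subset_closure hΩ.measurableSet
      hφ.continuous,
    memLp_restrict_of_continuous hb.isCompact_closure subset_closure hΩ.measurableSet
      (continuous_gradient hφ), fun ψ hψ hψc hψΩ w => ?_⟩
  have h0 : ∀ x, x ∉ Ω → ψ x = 0 := fun x hx =>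
    image_eq_zero_of_notMem_tsupport fun h => hx (hψΩ h)
  have h0' : ∀ x, x ∉ Ω → fderiv ℝ ψ x = 0 := fun x hx =>
    image_eq_zero_of_notMem_tsupport fun h => hx (hψΩ (tsupport_fderiv_subset ℝ h))
  rw [setIntegral_eq_integral_of_forall_compl_eq_zero fun x hx => by simp [h0' x hx],
    setIntegral_eq_integral_of_forall_compl_eq_zero fun x hx => by simp [h0 x hx]]
  simp_rw [inner_gradient_left]
  exact integral_mul_dirDeriv hφ hψ hψc w

/-- The constant sequence φ serves as the approximation, so smooth functions enter the weak
formulation with their own boundary values. -/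
theorem isTrace_of_contDiff {Ω : Set 𝔼} (hb : Bornology.IsBounded Ω)
    [IsFiniteMeasure (surfaceMeasure Ω)] {φ : 𝔼 → ℝ} (hφ : ContDiff ℝ ∞ φ) :
    IsTrace Ω φ (∇ φ) φ := by
  have : IsFiniteMeasure ((Measure.euclideanHausdorffMeasure (d - 1) : Measure 𝔼).restrict
    (frontier Ω)) := ‹IsFiniteMeasure (surfaceMeasure Ω)›
  exact ⟨memLp_restrict_of_continuous hb.isCompact_closure frontier_subset_closure
    isClosed_frontier.measurableSet hφ.continuous, fun _ => φ, fun _ => hφ, by simp, by simp,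
    by simp⟩

theorem integrable_inner_of_memLp {α : Type*} [MeasurableSpace α] {μ : Measure α} {G H : α → 𝔼}
    (hG : MemLp G 2 μ) (hH : MemLp H 2 μ) : Integrable (fun x => inner ℝ (G x) (H x)) μ :=
  (hG.norm.integrable_mul hH.norm).mono' (hG.1.inner hH.1)
    (Eventually.of_forall fun _ => norm_inner_le_norm _ _)

theorem isWeakGradient_sum {Ω : Set 𝔼} {ι : Type*} {s : Finset ι} {u : ι → 𝔼 → ℝ} {G : ι → 𝔼 → 𝔼}
    (h : ∀ i, IsSobolevH1 Ω (u i) (G i)) (hΩ : IsOpen Ω) (hb : Bornology.IsBounded Ω) (c : ι → ℝ) :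
    IsWeakGradient Ω (fun x => ∑ i ∈ s, c i * u i x) (fun x => ∑ i ∈ s, c i • G i x) := by
  intro φ hφ hφc hφΩ w
  have := hb.volume_restrict_isFiniteMeasure
  have h1 : MemLp φ 2 (volume.restrict Ω) := memLp_restrict_of_continuous hb.isCompact_closure
    subset_closure hΩ.measurableSet hφ.continuous
  have h2 : MemLp (dirDeriv w φ) 2 (volume.restrict Ω) := memLp_restrict_of_continuous
    hb.isCompact_closure subset_closure hΩ.measurableSet (contDiff_dirDeriv hφ w).continuous
  have h3 : MemLp (fun x => φ x • w) 2 (volume.restrict Ω) := memLp_restrict_of_continuous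
    hb.isCompact_closure subset_closure hΩ.measurableSet (hφ.continuous.smul continuous_const)
  have e1 : ∀ x, (∑ i ∈ s, c i * u i x) * fderiv ℝ φ x w =
      ∑ i ∈ s, c i * (u i x * fderiv ℝ φ x w) := fun x => by
    rw [Finset.sum_mul]; simp_rw [mul_assoc]
  have e2 : ∀ x, inner ℝ (∑ i ∈ s, c i • G i x) w * φ x =
      ∑ i ∈ s, c i * (inner ℝ (G i x) w * φ x) := fun x => by
    rw [sum_inner, Finset.sum_mul]; simp_rw [real_inner_smul_left, mul_assoc]
  have i2 : ∀ i, Integrable (fun x => inner ℝ (G i x) w * φ x) (volume.restrict Ω) := fun i =>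
    (integrable_inner_of_memLp (h i).memLp_grad h3).congr (Eventually.of_forall fun x => by
      simp [real_inner_smul_right, mul_comm])
  have i1 : ∀ i, Integrable (fun x => u i x * fderiv ℝ φ x w) (volume.restrict Ω) := fun i =>
    (h i).memLp.integrable_mul h2
  simp_rw [e1, e2]
  rw [integral_finsetSum _ fun i _ => (i1 i).const_mul (c i),
    integral_finsetSum _ fun i _ => (i2 i).const_mul (c i), ← Finset.sum_neg_distrib]
  refine Finset.sum_congr rfl fun i _ => ?_
  rw [integral_const_mul, integral_const_mul, (h i).isWeakGradient φ hφ hφc hφΩ w, mul_neg]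

theorem isSobolevH1_sum {Ω : Set 𝔼} {ι : Type*} {s : Finset ι} {u : ι → 𝔼 → ℝ} {G : ι → 𝔼 → 𝔼}
    (h : ∀ i, IsSobolevH1 Ω (u i) (G i)) (hΩ : IsOpen Ω) (hb : Bornology.IsBounded Ω) (c : ι → ℝ) :
    IsSobolevH1 Ω (fun x => ∑ i ∈ s, c i * u i x) (fun x => ∑ i ∈ s, c i • G i x) :=
  ⟨memLp_finsetSum s fun i _ => (h i).memLp.const_mul (c i),
    memLp_finsetSum s fun i _ => (h i).memLp_grad.const_smul (c i),
    isWeakGradient_sum h hΩ hb c⟩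

/-- An `H¹` function satisfying the weak Helmholtz equation for all test functions, extended by
zero, is a distributional solution. -/
theorem IsSobolevH1.isDistribSolution {Ω : Set 𝔼} {w : 𝔼 → ℝ} {W : 𝔼 → 𝔼}
    (hw : IsSobolevH1 Ω w W) (hΩ : IsOpen Ω) (hb : Bornology.IsBounded Ω) {l : ℝ}
    (heq : ∀ φ : 𝔼 → ℝ, ContDiff ℝ ∞ φ → HasCompactSupport φ → tsupport φ ⊆ Ω →
      ∫ x in Ω, (inner ℝ (W x) (∇ φ x) - l * w x * φ x) = 0) :
    IsDistribSolution Ω l (Ω.indicator w) := by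
  intro φ hφ hφc hφΩ
  have := hb.volume_restrict_isFiniteMeasure
  have hmem : ∀ {F : Type} [NormedAddCommGroup F] [SecondCountableTopology F] {f : 𝔼 → F},
      Continuous f → MemLp f 2 (volume.restrict Ω) := fun hf =>
    memLp_restrict_of_continuous hb.isCompact_closure subset_closure hΩ.measurableSet hf
  let b : Fin d → 𝔼 := fun i => EuclideanSpace.single i 1
  have hD : ∀ i, ContDiff ℝ ∞ (dirDeriv (b i) φ) := fun i => contDiff_dirDeriv hφ _
  -- The weak gradient is tested against ∂ᵢφ, which is again an admissible test function.
  have h1 : ∀ i, ∫ x in Ω, w x * dirDeriv (b i) (dirDeriv (b i) φ) x =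
      -∫ x in Ω, W x i * dirDeriv (b i) φ x := by
    intro i
    have := hw.isWeakGradient (dirDeriv (b i) φ) (hD i) (hasCompactSupport_dirDeriv hφc _)
      ((tsupport_dirDeriv_subset φ _).trans hφΩ) (b i)
    simpa [b, dirDeriv, EuclideanSpace.inner_single_right] using this
  have h2 : ∀ x, inner ℝ (W x) (∇ φ x) = ∑ i, W x i * dirDeriv (b i) φ x := by
    intro x
    rw [real_inner_comm, inner_gradient_left, fderiv_apply_eq_sum]
    rfl
  have iW : ∀ i, Integrable (fun x => W x i * dirDeriv (b i) φ x) (volume.restrict Ω) := by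
    intro i
    refine (integrable_inner_of_memLp hw.memLp_grad
      (hmem ((hD i).continuous.smul (continuous_const (y := b i))))).congr
      (Eventually.of_forall fun x => ?_)
    simp [b, real_inner_smul_right, EuclideanSpace.inner_single_right, mul_comm]
  have iD : ∀ i, Integrable (fun x => w x * dirDeriv (b i) (dirDeriv (b i) φ) x)
      (volume.restrict Ω) := fun i =>
    hw.memLp.integrable_mul (hmem (contDiff_dirDeriv (hD i) (b i)).continuous)
  have h3 : ∫ x in Ω, inner ℝ (W x) (∇ φ x) = -∫ x in Ω, w x * coordLaplacian φ x := by
    simp_rw [h2, coordLaplacian, Finset.mul_sum]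
    rw [integral_finsetSum _ fun i _ => iW i, integral_finsetSum _ fun i _ => iD i,
      ← Finset.sum_neg_distrib]
    refine Finset.sum_congr rfl fun i _ => ?_
    rw [h1, neg_neg]
  have iw : Integrable (fun x => w x * φ x) (volume.restrict Ω) :=
    hw.memLp.integrable_mul (hmem hφ.continuous)
  have iL : Integrable (fun x => w x * coordLaplacian φ x) (volume.restrict Ω) :=
    hw.memLp.integrable_mul (hmem (contDiff_coordLaplacian hφ).continuous)
  have h4 := heq φ hφ hφc hφΩ
  simp_rw [mul_assoc] at h4
  rw [integral_sub (integrable_inner_of_memLp hw.memLp_grad (hmem (continuous_gradient hφ)))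
    (iw.const_mul l), h3, integral_const_mul] at h4
  have h5 : ∀ x, (coordLaplacian φ x + l * φ x) * Ω.indicator w x =
      Ω.indicator (fun x => w x * coordLaplacian φ x + l * (w x * φ x)) x := by
    intro x
    by_cases hx : x ∈ Ω
    · simp only [indicator_of_mem hx]; ring
    · simp [hx]
  simp_rw [h5]
  rw [integral_indicator hΩ.measurableSet, integral_add iL (iw.const_mul l), integral_const_mul]
  linarith

/-- The weak gradient of a function vanishing almost everywhere vanishes almost everywhere. -/
theorem IsSobolevH1.grad_ae_eq_zero {Ω : Set 𝔼} {w : 𝔼 → ℝ} {W : 𝔼 → 𝔼}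
    (hw : IsSobolevH1 Ω w W) (hΩ : IsOpen Ω) (hb : Bornology.IsBounded Ω)
    (h0 : w =ᵐ[volume.restrict Ω] 0) : W =ᵐ[volume.restrict Ω] 0 := by
  have := hb.volume_restrict_isFiniteMeasure
  have hint : IntegrableOn W Ω := hw.memLp_grad.integrable (by norm_num)
  have key : ∀ i : Fin d, ∀ᵐ x, x ∈ Ω → W x i = 0 := by
    intro i
    have hi : IntegrableOn (fun x => W x i) Ω :=
      (EuclideanSpace.proj i : 𝔼 →L[ℝ] ℝ).integrable_comp hint
    -- Fundamental lemma of the calculus of variations, one component at a time.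
    refine hΩ.ae_eq_zero_of_integral_contDiff_smul_eq_zero hi.locallyIntegrableOn
      fun φ hφ hφc hφΩ => ?_
    have h1 := hw.isWeakGradient φ hφ hφc hφΩ (EuclideanSpace.single i 1)
    rw [integral_eq_zero_of_ae (h0.mono fun x hx => by simp [hx])] at h1
    rw [← setIntegral_eq_integral_of_forall_compl_eq_zero (s := Ω) fun x hx => by
      simp [image_eq_zero_of_notMem_tsupport fun h => hx (hφΩ h)]]
    simp only [EuclideanSpace.inner_single_right, one_mul] at h1
    simp_rw [smul_eq_mul, mul_comm (φ _)]
    simpa using h1.symm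
  rw [EventuallyEq, ae_restrict_iff' hΩ.measurableSet]
  filter_upwards [ae_all_iff.2 key] with x hx hxΩ
  ext i
  simpa using hx i hxΩ

/-- Testing the weak formulation of a linear combination of solutions with smooth functions. -/
theorem integral_weak_formulation_sum {Ω : Set 𝔼} (hΩ : IsOpen Ω) (hb : Bornology.IsBounded Ω)
    [IsFiniteMeasure (surfaceMeasure Ω)] {l : ℝ} {n : ℕ} {g : Fin n → Lp ℝ 2 (surfaceMeasure Ω)}
    {u : Fin n → 𝔼 → ℝ} {G : Fin n → 𝔼 → 𝔼} (hG : ∀ i, IsSobolevH1 Ω (u i) (G i))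
    (heq : ∀ i v H t, IsSobolevH1 Ω v H → IsTrace Ω v H t →
      ∫ x in Ω, (inner ℝ (G i x) (H x) - l * u i x * v x) = ∫ x, g i x * t x ∂(surfaceMeasure Ω))
    (c : Fin n → ℝ) {φ : 𝔼 → ℝ} (hφ : ContDiff ℝ ∞ φ) :
    ∫ x in Ω, (inner ℝ (∑ i, c i • G i x) (∇ φ x) - l * (∑ i, c i * u i x) * φ x) =
      ∫ x, (∑ i, c i • g i : Lp ℝ 2 (surfaceMeasure Ω)) x * φ x ∂(surfaceMeasure Ω) := by
  have hφ1 := isSobolevH1_of_contDiff hΩ hb hφ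
  have hφt := isTrace_of_contDiff hb hφ
  have e1 : ∀ x, inner ℝ (∑ i, c i • G i x) (∇ φ x) - l * (∑ i, c i * u i x) * φ x =
      ∑ i, c i * (inner ℝ (G i x) (∇ φ x) - l * u i x * φ x) := by
    intro x
    rw [sum_inner, Finset.mul_sum, Finset.sum_mul, ← Finset.sum_sub_distrib]
    refine Finset.sum_congr rfl fun i _ => ?_
    rw [real_inner_smul_left]
    ring
  have e2 : ∀ᵐ x ∂(surfaceMeasure Ω), (∑ i, c i • g i : Lp ℝ 2 (surfaceMeasure Ω)) x * φ x =
      ∑ i, c i * (g i x * φ x) := by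
    filter_upwards [Lp.coeFn_finsetSum Finset.univ fun i => c i • g i,
      ae_all_iff.2 fun i => Lp.coeFn_smul (c i) (g i)] with x hx hx'
    rw [hx, Finset.sum_apply, Finset.sum_mul]
    refine Finset.sum_congr rfl fun i _ => ?_
    rw [hx' i, Pi.smul_apply, smul_eq_mul, mul_assoc]
  have i1 : ∀ i, Integrable (fun x => inner ℝ (G i x) (∇ φ x) - l * u i x * φ x)
      (volume.restrict Ω) := by
    intro i
    have := ((hG i).memLp.integrable_mul hφ1.memLp).const_mul l
    refine (integrable_inner_of_memLp (hG i).memLp_grad hφ1.memLp_grad).sub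
      (this.congr (Eventually.of_forall fun x => ?_))
    simp [mul_assoc]
  have i2 : ∀ i, Integrable (fun x => g i x * φ x) (surfaceMeasure Ω) := fun i =>
    (Lp.memLp (g i)).integrable_mul hφt.1
  simp_rw [e1]
  rw [integral_congr_ae e2, integral_finsetSum _ fun i _ => (i1 i).const_mul (c i),
    integral_finsetSum _ fun i _ => (i2 i).const_mul (c i)]
  refine Finset.sum_congr rfl fun i _ => ?_
  rw [integral_const_mul, integral_const_mul, heq i φ _ φ hφ1 hφt]

/-! ### Linear independence of the fields on a pixel and positivity -/

/-- If a linear combination of solutions with linearly independent Neumann data vanishes on a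
nonempty open set, then it is the trivial combination. -/
theorem eq_zero_of_sum_ae_eq_zero (hd : 2 ≤ d) {Ω : Set 𝔼} (hΩ : IsLipschitzDomain Ω) {k q₀ : ℝ}
    {n : ℕ} {g : Fin n → Lp ℝ 2 (surfaceMeasure Ω)} (hg : LinearIndependent ℝ g)
    {u : Fin n → 𝔼 → ℝ} (hu : ∀ i, IsWeakSolution Ω k (fun _ => q₀) (g i) (u i))
    {P : Set 𝔼} (hP : IsOpen P) (hne : P.Nonempty) (hPΩ : P ⊆ Ω) (c : Fin n → ℝ)
    (h0 : ∀ᵐ x, x ∈ P → ∑ i, c i * u i x = 0) : c = 0 := by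
  have := hΩ.isFiniteMeasure_surfaceMeasure hd
  have := hΩ.isBounded.volume_restrict_isFiniteMeasure
  choose G hG heq using hu
  have hw := isSobolevH1_sum (s := Finset.univ) hG hΩ.isOpen hΩ.isBounded c
  have hweak := fun (φ : 𝔼 → ℝ) (hφ : ContDiff ℝ ∞ φ) =>
    integral_weak_formulation_sum hΩ.isOpen hΩ.isBounded (g := g) hG heq c hφ
  have hsol := hw.isDistribSolution (l := k ^ 2 * q₀) hΩ.isOpen hΩ.isBounded
    fun φ hφ hφc hφΩ => by
      rw [hweak φ hφ]
      -- The boundary term vanishes: the support of φ lies in the open set Ω, so φ = 0 on ∂Ω.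
      refine integral_eq_zero_of_ae ?_
      filter_upwards [ae_restrict_mem isClosed_frontier.measurableSet] with x hx
      have : φ x = 0 := image_eq_zero_of_notMem_tsupport fun h => by
        rw [hΩ.isOpen.frontier_eq] at hx
        exact hx.2 (hφΩ h)
      simp [this]
  have hloc : LocallyIntegrable (Ω.indicator fun x => ∑ i, c i * u i x) :=
    ((integrable_indicator_iff hΩ.isOpen.measurableSet).2
      (hw.memLp.integrable (by norm_num))).locallyIntegrable
  have hzero := hsol.ae_eq_zero hΩ.isOpen hΩ.isConnected.isPreconnected hloc hP hne hPΩ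
    (h0.mono fun x hx hxP => by rw [indicator_of_mem (hPΩ hxP)]; exact hx hxP)
  have hw0 : (fun x => ∑ i, c i * u i x) =ᵐ[volume.restrict Ω] 0 := by
    rw [EventuallyEq, ae_restrict_iff' hΩ.isOpen.measurableSet]
    filter_upwards [hzero] with x hx hxΩ
    simpa [hxΩ] using hx hxΩ
  have hW0 := hw.grad_ae_eq_zero hΩ.isOpen hΩ.isBounded hw0
  have hsum : (∑ i, c i • g i : Lp ℝ 2 (surfaceMeasure Ω)) = 0 := by
    rw [Lp.eq_zero_iff_ae_eq_zero]
    -- Here φ is unrestricted on ∂Ω. The left side of the weak formulation is zero because w and its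
    -- gradient vanish, so the datum integrates to zero against every such φ.
    refine ae_eq_zero_of_integral_contDiff_smul_eq_zero
      ((Lp.memLp _).integrable (by norm_num)).locallyIntegrable fun φ hφ _ => ?_
    simp_rw [smul_eq_mul, mul_comm (φ _)]
    rw [← hweak φ hφ]
    refine integral_eq_zero_of_ae ?_
    filter_upwards [hw0, hW0] with x hx hx'
    simp only [Pi.zero_apply] at hx hx' ⊢
    rw [hx, hx']
    simp
  exact funext fun i => Fintype.linearIndependent_iff.1 hg c hsum i

/-- The quadratic form of the linearized measurement matrix. -/
theorem dotProduct_linearizedMeasurement_mulVec {Ω P : Set 𝔼} (hP : MeasurableSet P) {k : ℝ}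
    {n : ℕ} {u : Fin n → 𝔼 → ℝ} (hu : ∀ i, MemLp (u i) 2 (volume.restrict Ω)) (c : Fin n → ℝ) :
    c ⬝ᵥ (linearizedMeasurement Ω k u (P.indicator fun _ => (1 : ℝ))).mulVec c =
      ∫ x in Ω, P.indicator (fun x => k ^ 2 * (∑ i, c i * u i x) ^ 2) x := by
  have hI : ∀ i j, Integrable (fun x => k ^ 2 * P.indicator (fun _ => (1 : ℝ)) x * u i x * u j x)
      (volume.restrict Ω) := by
    intro i j
    refine (Integrable.indicator (((hu i).integrable_mul (hu j)).const_mul (k ^ 2)) hP).congr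
      (Eventually.of_forall fun x => ?_)
    by_cases hx : x ∈ P <;> simp [hx, mul_assoc]
  have e : ∀ x, P.indicator (fun x => k ^ 2 * (∑ i, c i * u i x) ^ 2) x =
      ∑ i, ∑ j, c i * c j * (k ^ 2 * P.indicator (fun _ => (1 : ℝ)) x * u i x * u j x) := by
    intro x
    by_cases hx : x ∈ P
    · simp only [indicator_of_mem hx]
      rw [pow_two (∑ i, c i * u i x), Finset.sum_mul_sum, Finset.mul_sum]
      refine Finset.sum_congr rfl fun i _ => ?_
      rw [Finset.mul_sum]
      exact Finset.sum_congr rfl fun j _ => by ring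
    · simp [hx]
  simp_rw [e]
  rw [integral_finsetSum _ fun i _ => integrable_finsetSum _ fun j _ => (hI i j).const_mul _]
  simp_rw [dotProduct, Matrix.mulVec, dotProduct, Finset.mul_sum]
  refine Finset.sum_congr rfl fun i _ => ?_
  rw [integral_finsetSum _ fun j _ => (hI i j).const_mul _]
  refine Finset.sum_congr rfl fun j _ => ?_
  rw [integral_const_mul]
  simp only [linearizedMeasurement, Matrix.of_apply]
  ring

end Helmholtz

theorem lemma3p4 {d : ℕ} (hd : 2 ≤ d) (Ω : Set (EuclideanSpace ℝ (Fin d)))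
    (hΩ : Helmholtz.IsLipschitzDomain Ω) (k : ℝ) (hk : 0 < k) (q₀ : ℝ) (hq₀ : 0 < q₀)
    (hres : ¬ Helmholtz.IsResonant Ω k (fun _ => q₀))
    {n : ℕ} (g : Fin n → Lp ℝ 2 (Helmholtz.surfaceMeasure Ω)) (hg : Orthonormal ℝ g)
    (u : Fin n → EuclideanSpace ℝ (Fin d) → ℝ)
    (hu : ∀ i, Helmholtz.IsWeakSolution Ω k (fun _ => q₀) (g i) (u i))
    {M : ℕ} (P : Fin M → Set (EuclideanSpace ℝ (Fin d)))
    (hP : Helmholtz.IsPixelPartition Ω P) (m : Fin M) :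
    (Helmholtz.linearizedMeasurement Ω k u ((P m).indicator fun _ => (1 : ℝ))).PosDef := by
  have hL2 : ∀ i, MemLp (u i) 2 (volume.restrict Ω) := fun i => (hu i).choose_spec.1.memLp
  have hPm := (hP.isOpen m).measurableSet
  refine Matrix.PosDef.of_dotProduct_mulVec_pos ?_ fun c hc => ?_
  · refine Matrix.IsHermitian.ext fun i j => ?_
    simp only [Helmholtz.linearizedMeasurement, Matrix.of_apply, star_trivial]
    exact integral_congr_ae (Eventually.of_forall fun x => by ring)
  rw [star_trivial, Helmholtz.dotProduct_linearizedMeasurement_mulVec hPm hL2]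
  have hsum : MemLp (fun x => ∑ i, c i * u i x) 2 (volume.restrict Ω) :=
    memLp_finsetSum _ fun i _ => (hL2 i).const_mul (c i)
  have hint : Integrable ((P m).indicator fun x => k ^ 2 * (∑ i, c i * u i x) ^ 2)
      (volume.restrict Ω) := (hsum.integrable_sq.const_mul (k ^ 2)).indicator hPm
  have hnonneg : 0 ≤ (P m).indicator fun x => k ^ 2 * (∑ i, c i * u i x) ^ 2 :=
    indicator_nonneg fun x _ => by positivity
  -- A zero integral of the nonnegative k² w² forces w = 0 a.e. on the pixel, as k ≠ 0, and hence c
  -- = 0.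
  refine (integral_nonneg hnonneg).lt_of_ne' fun hzero => hc ?_
  rw [integral_eq_zero_iff_of_nonneg hnonneg hint, EventuallyEq,
    ae_restrict_iff' hΩ.isOpen.measurableSet] at hzero
  refine Helmholtz.eq_zero_of_sum_ae_eq_zero hd hΩ hg.linearIndependent hu (hP.isOpen m)
    (hP.nonempty m) (hP.subset m) c (hzero.mono fun x hx hxP => ?_)
  simpa [hxP, hk.ne'] using hx (hP.subset m hxP)
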